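/- Let $n\ge 0$ and $k\ge 1$ be integers with $k>n+1$. For $|z|<1$ let $$\mathrm{Li}_{-n,k}(z)=\sum_{0<m_1<m_2}\frac{m_1^{\,n}\,z^{m_2}}{m_2^{\,k}},$$ which converges absolutely, and for $\Re(s)>0$ define $$\xi(-n,k;s)=\frac{1}{\Gamma(s)}\int_0^\infty t^{s-1}\,\frac{\mathrm{Li}_{-n,k}(1-e^{-t})}{e^t-1}\,dt ,$$ where the integral converges absolutely. Let the multi-poly-Bernoulli numbers $C_m^{(-n,k)}$ $(m\ge 0)$ be defined by the Taylor expansion at $t=0$ (a removable singularity of the left-hand side) $$\frac{\mathrm{Li}_{-n,k}(1-e^{-t})}{e^t-1}=\sum_{m=0}^\infty C_m^{(-n,k)}\frac{t^m}{m!},$$ valid for all complex $t\ne 0$ sufficiently close to $0$. Then $\xi(-n,k;s)$ extends to an entire function of $s\in\mathbb{C}$, and the values of this (unique) extension at the nonpositive integers are $$\xi(-n,k;-m)=(-1)^m\,C_m^{(-n,k)}\qquad (m\in\mathbb{Z}_{\ge 0}).$$ -/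

import Mathlib

open Filter Topology MeasureTheory

noncomputable section

/-- The double polylogarithm `Li_{k₁,k₂}(z) = ∑_{0 < m₁ < m₂} z ^ m₂ / (m₁ ^ k₁ * m₂ ^ k₂)`, `|z| < 1`,
for arbitrary integers `k₁`, `k₂`. For each `m₂` the inner sum runs over the finitely many
`1 ≤ m₁ < m₂`. -/
def doublePolylog (k₁ k₂ : ℤ) (z : ℂ) : ℂ :=
  ∑' m₂ : ℕ, ∑ m₁ ∈ Finset.Ico 1 m₂, z ^ m₂ / ((m₁ : ℂ) ^ k₁ * (m₂ : ℂ) ^ k₂)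

/-- The function `Li_{k₁,k₂}(1 - e^{-t}) / (e^t - 1)`. -/
def xiKernel (k₁ k₂ : ℤ) (t : ℂ) : ℂ :=
  doublePolylog k₁ k₂ (1 - Complex.exp (-t)) / (Complex.exp t - 1)

/-- The multi-poly-Bernoulli number `C_m^{(k₁,k₂)}`, i.e. `m!` times the coefficient of `t ^ m` in
the Taylor expansion of `Li_{k₁,k₂}(1 - e^{-t}) / (e^t - 1)` at `t = 0`. The function is completed
at its removable singularity `t = 0` by its limit. -/
def multiPolyBernoulliC (k₁ k₂ : ℤ) (m : ℕ) : ℂ :=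
  iteratedDeriv m
    (Function.update (xiKernel k₁ k₂) 0 (limUnder (𝓝[≠] (0 : ℂ)) (xiKernel k₁ k₂))) 0

/-- The integrand `t ^ (s - 1) * Li_{k₁,k₂}(1 - e^{-t}) / (e^t - 1)`, `t > 0`. -/
def xiIntegrand (k₁ k₂ : ℤ) (s : ℂ) (t : ℝ) : ℂ :=
  (t : ℂ) ^ (s - 1) * xiKernel k₁ k₂ (t : ℂ)

/-- The zeta function of Arakawa-Kaneko type `ξ(k₁,k₂;s)`, given by its defining integral
(for `Re s > 0`). -/
def xiIntegral (k₁ k₂ : ℤ) (s : ℂ) : ℂ :=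
  1 / Complex.Gamma s * ∫ t in Set.Ioi (0 : ℝ), xiIntegrand k₁ k₂ s t

end

/-! Up to the factor `1/Γ(s)`, `ξ` is the Mellin transform of a kernel with exponential decay at
infinity and a Taylor expansion `∑ c j * t ^ j` at `0`. Subtracting the Taylor polynomial cut off to
`(0, 1]` leaves a Mellin transform holomorphic for `Re s > -N`; the polynomial contributes the
simple poles `c j / (s + j)`. The zeros of `1/Γ` cancel these poles, and at `s = -m` only `j = m`
survives, with value `(-1) ^ m * m! * c m` (`exists_entire_continuation_mellin`). The decay comes
from `k > n + 1`: the coefficients of `Li_{-n,k}` are at most `1 / m`, so it is dominated by `-log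
(1 - x)`, which equals `t` at `x = 1 - e^{-t}`. -/

/-! ### The reciprocal Gamma function and its zeros -/

/-- The entire function `s ↦ 1 / ((s + j) Γ(s))`. -/
noncomputable def invGammaShift (j : ℕ) (s : ℂ) : ℂ :=
  (∏ i ∈ Finset.range j, (s + i)) * (Complex.Gamma (s + j + 1))⁻¹

theorem differentiable_invGammaShift (j : ℕ) : Differentiable ℂ (invGammaShift j) := by
  refine Differentiable.mul ?_ ?_
  · exact Differentiable.fun_finsetProd fun i _ => differentiable_id.add_const _
  · exact Complex.differentiable_one_div_Gamma.comp
      ((differentiable_id.add_const (j : ℂ)).add_const 1)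

theorem inv_Gamma_eq_prod_mul (j : ℕ) (s : ℂ) :
    (Complex.Gamma s)⁻¹ = (∏ i ∈ Finset.range j, (s + i)) * (Complex.Gamma (s + j))⁻¹ := by
  induction j with
  | zero => simp
  | succ j ih =>
    rw [ih, Complex.one_div_Gamma_eq_self_mul_one_div_Gamma_add_one, Finset.prod_range_succ]
    push_cast
    ring_nf

theorem inv_Gamma_mul_one_div (j : ℕ) {s : ℂ} (hs : s + j ≠ 0) :
    (Complex.Gamma s)⁻¹ * (1 / (s + j)) = invGammaShift j s := by
  rw [inv_Gamma_eq_prod_mul j s, Complex.one_div_Gamma_eq_self_mul_one_div_Gamma_add_one,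
    invGammaShift]
  field_simp

theorem invGammaShift_neg_self (m : ℕ) : invGammaShift m (-m) = (-1) ^ m * m.factorial := by
  have h : ∀ k : ℕ, ∏ i ∈ Finset.range k, (-(k : ℂ) + i) = (-1) ^ k * k.factorial := by
    intro k
    induction k with
    | zero => simp
    | succ k ih =>
      rw [Finset.prod_range_succ', Nat.factorial_succ, pow_succ]
      have : ∏ i ∈ Finset.range k, (-((k + 1 : ℕ) : ℂ) + ((i + 1 : ℕ) : ℂ)) =
          ∏ i ∈ Finset.range k, (-(k : ℂ) + i) :=
        Finset.prod_congr rfl fun i _ => by push_cast; ring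
      rw [this, ih]
      push_cast
      ring
  simp [invGammaShift, h]

theorem invGammaShift_neg_of_lt {j m : ℕ} (h : j < m) : invGammaShift j (-m) = 0 := by
  obtain ⟨d, rfl⟩ := Nat.exists_eq_add_of_lt h
  have : (-((j + d + 1 : ℕ) : ℂ) + j + 1) = -(d : ℂ) := by push_cast; ring
  -- `Complex.Gamma` is `0` at its poles by convention, so its inverse there is the true value `0`
  -- of `1/Γ`.
  rw [invGammaShift, this, Complex.Gamma_neg_nat_eq_zero, inv_zero, mul_zero]

/-! ### Continuation of Mellin transforms -/

/-- The truncation to `(0, 1]` of the Taylor polynomial of degree `< N` with coefficients `c`. -/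
noncomputable def truncTaylor (c : ℕ → ℂ) (N : ℕ) (t : ℝ) : ℂ :=
  ∑ j ∈ Finset.range N, c j * Set.indicator (Set.Ioc 0 1) (fun t : ℝ => (t : ℂ) ^ (j : ℂ)) t

theorem hasMellin_truncTaylor (c : ℕ → ℂ) (N : ℕ) {s : ℂ} (hs : 0 < s.re) :
    HasMellin (truncTaylor c N) s (∑ j ∈ Finset.range N, c j * (1 / (s + j))) := by
  induction N with
  | zero =>
    simp only [HasMellin, MellinConvergent, mellin, truncTaylor, Finset.range_zero,
      Finset.sum_empty, smul_zero, integral_zero, and_true]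
    exact integrableOn_zero
  | succ N ih =>
    have h1 := hasMellin_cpow_Ioc (N : ℂ) (s := s) (by simp; positivity)
    have h2 : HasMellin (fun t : ℝ => c N •
        Set.indicator (Set.Ioc 0 1) (fun t : ℝ => (t : ℂ) ^ (N : ℂ)) t) s
        (c N • (1 / (s + N))) :=
      ⟨h1.1.const_smul _, by rw [mellin_const_smul, h1.2]⟩
    have h3 := hasMellin_add ih.1 h2.1
    rw [ih.2, h2.2] at h3
    have e : (fun t => truncTaylor c N t + c N •
        Set.indicator (Set.Ioc 0 1) (fun t : ℝ => (t : ℂ) ^ (N : ℂ)) t) =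
        truncTaylor c (N + 1) := by
      funext t
      simp only [truncTaylor, Finset.sum_range_succ, smul_eq_mul]
    rw [Finset.sum_range_succ]
    rw [e] at h3
    exact h3

theorem locallyIntegrableOn_truncTaylor (c : ℕ → ℂ) (N : ℕ) :
    LocallyIntegrableOn (truncTaylor c N) (Set.Ioi 0) := by
  have h := (hasMellin_truncTaylor c N (s := 1) (by simp)).1
  simp only [MellinConvergent, sub_self, Complex.cpow_zero, one_smul] at h
  exact h.locallyIntegrableOn

theorem truncTaylor_eq_zero (c : ℕ → ℂ) (N : ℕ) : truncTaylor c N =ᶠ[atTop] 0 := by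
  filter_upwards [eventually_gt_atTop 1] with t ht
  have : t ∉ Set.Ioc (0 : ℝ) 1 := fun h => absurd h.2 (not_le.mpr ht)
  simp [truncTaylor, Set.indicator_of_notMem this]

theorem truncTaylor_eq_sum (c : ℕ → ℂ) (N : ℕ) :
    truncTaylor c N =ᶠ[𝓝[>] 0] fun t => ∑ j ∈ Finset.range N, c j * (t : ℂ) ^ j := by
  filter_upwards [Ioc_mem_nhdsGT (zero_lt_one' ℝ)] with t ht
  simp [truncTaylor, Set.indicator_of_mem ht]

theorem mellin_sub_truncTaylor_succ (f : ℝ → ℂ) (c : ℕ → ℂ) (N : ℕ) {s : ℂ}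
    (hs : -(N : ℝ) < s.re) (hf : MellinConvergent (fun t => f t - truncTaylor c N t) s) :
    mellin (fun t => f t - truncTaylor c (N + 1) t) s =
      mellin (fun t => f t - truncTaylor c N t) s - c N * (1 / (s + N)) := by
  have h1 := hasMellin_cpow_Ioc (N : ℂ) (s := s) (by simp; linarith)
  have h2 : MellinConvergent (fun t : ℝ => c N •
      Set.indicator (Set.Ioc 0 1) (fun t : ℝ => (t : ℂ) ^ (N : ℂ)) t) s := h1.1.const_smul _
  have h3 := (hasMellin_sub hf h2).2
  rw [mellin_const_smul, h1.2, smul_eq_mul] at h3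
  rw [← h3]
  congr 1
  funext t
  simp only [truncTaylor, Finset.sum_range_succ, smul_eq_mul]
  ring

/-- If `f` decays exponentially at infinity and has the asymptotic expansion `∑ c j * t ^ j` at
`0`, then its normalised Mellin transform is entire, with values at the nonpositive integers given
by the `c j`. -/
theorem exists_entire_continuation_mellin {f : ℝ → ℂ} {c : ℕ → ℂ} {a : ℝ} (ha : 0 < a)
    (hfc : LocallyIntegrableOn f (Set.Ioi 0))
    (hf_top : f =O[atTop] fun t => Real.exp (-a * t))
    (hf_zero : ∀ N : ℕ, (fun t : ℝ => f t - ∑ j ∈ Finset.range N, c j * (t : ℂ) ^ j)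
      =O[𝓝[>] 0] fun t : ℝ => t ^ N) :
    ∃ Ξ : ℂ → ℂ, Differentiable ℂ Ξ ∧
      (∀ s : ℂ, 0 < s.re → Ξ s = (Complex.Gamma s)⁻¹ * mellin f s) ∧
      ∀ m : ℕ, Ξ (-(m : ℂ)) = (-1) ^ m * (m.factorial * c m) := by
  set R : ℕ → ℝ → ℂ := fun N t => f t - truncTaylor c N t with hR
  have hRc : ∀ N, LocallyIntegrableOn (R N) (Set.Ioi 0) := fun N =>
    hfc.sub (locallyIntegrableOn_truncTaylor c N)
  have hR_top : ∀ N, R N =O[atTop] fun t => Real.exp (-a * t) := fun N =>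
    hf_top.congr' ((truncTaylor_eq_zero c N).mono fun t ht => by simp [hR, ht]) .rfl
  have hR_zero : ∀ N : ℕ, R N =O[𝓝[>] 0] fun t : ℝ => t ^ (-(-(N : ℝ))) := fun N =>
    (hf_zero N).congr' ((truncTaylor_eq_sum c N).mono fun t ht => by simp [hR, ht])
      (.of_forall fun t => by simp)
  have hconv : ∀ (N : ℕ) (s : ℂ), -(N : ℝ) < s.re → MellinConvergent (R N) s := fun N s hs =>
    mellinConvergent_of_isBigO_rpow_exp ha (hRc N) (hR_top N) (hR_zero N) hs
  have hdiff : ∀ (N : ℕ) (s : ℂ), -(N : ℝ) < s.re → DifferentiableAt ℂ (mellin (R N)) s :=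
    fun N s hs =>
      mellin_differentiableAt_of_isBigO_rpow_exp ha (hRc N) (hR_top N) (hR_zero N) hs
  -- Candidate continuation on `Re s > -N`; the candidates agree on overlaps and glue to an entire
  -- function.
  set F : ℕ → ℂ → ℂ := fun N s => (Complex.Gamma s)⁻¹ * mellin (R N) s +
    ∑ j ∈ Finset.range N, c j * invGammaShift j s with hF
  have hFdiff : ∀ (N : ℕ) (s : ℂ), -(N : ℝ) < s.re → DifferentiableAt ℂ (F N) s := fun N s hs =>
    ((Complex.differentiable_one_div_Gamma s).mul (hdiff N s hs)).add
      (DifferentiableAt.fun_sum fun j _ => (differentiable_invGammaShift j s).const_mul _)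
  have hFsucc : ∀ (N : ℕ) (s : ℂ), -(N : ℝ) < s.re → F (N + 1) s = F N s := by
    intro N s hs
    have hne : s + N ≠ 0 := fun h => by
      have := congrArg Complex.re h
      simp at this
      linarith
    simp only [hF, hR, Finset.sum_range_succ]
    rw [mellin_sub_truncTaylor_succ f c N hs (hconv N s hs), ← inv_Gamma_mul_one_div N hne]
    ring
  have hFle : ∀ (N M : ℕ) (s : ℂ), -(N : ℝ) < s.re → N ≤ M → F M s = F N s := by
    intro N M s hs hNM
    induction M, hNM using Nat.le_induction with
    | base => rfl
    | succ M hM ih =>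
      have : (N : ℝ) ≤ M := by exact_mod_cast hM
      rw [hFsucc M s (by linarith), ih]
  have hFeq : ∀ (N M : ℕ) (s : ℂ), -(N : ℝ) < s.re → -(M : ℝ) < s.re → F M s = F N s := by
    intro N M s hN hM
    rcases le_total N M with h | h
    · exact hFle N M s hN h
    · exact (hFle M N s hM h).symm
  have hidx : ∀ s : ℂ, -((⌊-s.re⌋₊ + 1 : ℕ) : ℝ) < s.re := fun s => by
    have := Nat.lt_floor_add_one (-s.re)
    push_cast
    linarith
  -- The index depends on `s`, but near each point it may be frozen by `hFeq`.
  refine ⟨fun s => F (⌊-s.re⌋₊ + 1) s, fun s => ?_, fun s hs => ?_, fun m => ?_⟩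
  · refine (hFdiff _ s (hidx s)).congr_of_eventuallyEq ?_
    filter_upwards [(isOpen_lt continuous_const Complex.continuous_re).mem_nhds (hidx s)]
      with w hw
    exact hFeq _ _ w hw (hidx w)
  · have h0 : -((0 : ℕ) : ℝ) < s.re := by simpa using hs
    have e : R 0 = f := by funext t; simp [hR, truncTaylor]
    change F _ s = _
    rw [hFeq 0 _ s h0 (hidx s)]
    simp [hF, e]
  · change F _ _ = _
    -- `m + 1` is the least `N` whose half-plane contains `-m`.
    rw [hFeq (m + 1) _ _ (by simp) (hidx _)]
    simp only [hF, Complex.Gamma_neg_nat_eq_zero, inv_zero, zero_mul, zero_add,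
      Finset.sum_range_succ, invGammaShift_neg_self]
    rw [Finset.sum_eq_zero fun j hj => by
      rw [invGammaShift_neg_of_lt (Finset.mem_range.mp hj), mul_zero]]
    ring

/-- Removable singularity of a quotient whose denominator has a simple zero. -/
theorem analyticAt_update_div_of_simple_zero {f g h : ℂ → ℂ} (hf : AnalyticAt ℂ f 0)
    (hg : AnalyticAt ℂ g 0) (hf0 : f 0 = 0) (hg0 : g 0 = 0) (hg' : deriv g 0 ≠ 0)
    (hh : ∀ z, h z = f z / g z) :
    AnalyticAt ℂ (Function.update h 0 (limUnder (𝓝[≠] (0 : ℂ)) h)) 0 := by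
  have hd : ∀ u : ℂ → ℂ, AnalyticAt ℂ u 0 → AnalyticAt ℂ (dslope u 0) 0 := fun u ⟨_, hp⟩ =>
    hp.has_fpower_series_dslope_fslope.analyticAt
  have hq : AnalyticAt ℂ (fun z => dslope f 0 z / dslope g 0 z) 0 :=
    (hd f hf).fun_div (hd g hg) (by rwa [dslope_same])
  -- Dividing `f` and `g` by `z` cancels the common zero and leaves the denominator `g' 0 ≠ 0` at
  -- `0`.
  have he : ∀ z ≠ 0, h z = dslope f 0 z / dslope g 0 z := fun z hz => by
    rw [dslope_of_ne _ hz, dslope_of_ne _ hz, slope_def_field, slope_def_field, hf0, hg0, hh]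
    have : z - 0 ≠ 0 := by simpa using hz
    simp only [sub_zero] at this ⊢
    field_simp
  have hlim : limUnder (𝓝[≠] (0 : ℂ)) h = dslope f 0 0 / dslope g 0 0 :=
    Tendsto.limUnder_eq <| (hq.continuousAt.tendsto.mono_left nhdsWithin_le_nhds).congr' <| by
      filter_upwards [self_mem_nhdsWithin] with z hz using (he z hz).symm
  convert hq using 1
  funext z
  rcases eq_or_ne z 0 with rfl | hz
  · rw [Function.update_self, hlim]
  · rw [Function.update_of_ne hz, he z hz]

/-! ### Bounds for the polylogarithm -/

/-- The `m`-th power series coefficient of `Li_{-n,k}`. -/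
noncomputable def negPolylogCoeff (n k m : ℕ) : ℝ :=
  ∑ j ∈ Finset.Ico 1 m, (j : ℝ) ^ n / (m : ℝ) ^ k

theorem negPolylogCoeff_nonneg (n k m : ℕ) : 0 ≤ negPolylogCoeff n k m :=
  Finset.sum_nonneg fun _ _ => by positivity

/-- Fewer than `m` terms, each at most `m ^ (n - k)`, and `n + 1 - k ≤ -1`. The condition on `k`
enters the estimates here. -/
theorem negPolylogCoeff_le {n k : ℕ} (hk : n + 1 < k) (m : ℕ) :
    negPolylogCoeff n k m ≤ 1 / (m : ℝ) := by
  rcases Nat.eq_zero_or_pos m with rfl | hm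
  · simp [negPolylogCoeff]
  have hm1 : (1 : ℝ) ≤ m := by exact_mod_cast hm
  have hm0 : (0 : ℝ) < m := by positivity
  calc negPolylogCoeff n k m ≤ ∑ j ∈ Finset.Ico 1 m, (m : ℝ) ^ n / (m : ℝ) ^ k := by
        refine Finset.sum_le_sum fun j hj => ?_
        have : (j : ℝ) ≤ m := by exact_mod_cast (Finset.mem_Ico.mp hj).2.le
        gcongr
    _ ≤ m * ((m : ℝ) ^ n / (m : ℝ) ^ k) := by
        rw [Finset.sum_const, Nat.card_Ico, nsmul_eq_mul]
        gcongr
        exact_mod_cast Nat.sub_le m 1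
    _ = (m : ℝ) ^ (n + 2) / (m ^ k * m) := by field_simp; ring
    _ ≤ (m : ℝ) ^ k / (m ^ k * m) := by
        gcongr
        exact hk
    _ = 1 / m := by field_simp

theorem negPolylog_term (n k m j : ℕ) (z : ℂ) :
    z ^ m / ((j : ℂ) ^ (-(n : ℤ)) * (m : ℂ) ^ (k : ℤ)) =
      (((j : ℝ) ^ n / (m : ℝ) ^ k : ℝ) : ℂ) * z ^ m := by
  rw [zpow_neg, zpow_natCast, zpow_natCast]
  push_cast
  rw [div_eq_mul_inv, mul_inv, inv_inv]
  ring

theorem negPolylog_sum_norm (n k m : ℕ) (z : ℂ) :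
    ∑ j ∈ Finset.Ico 1 m, ‖z ^ m / ((j : ℂ) ^ (-(n : ℤ)) * (m : ℂ) ^ (k : ℤ))‖ =
      negPolylogCoeff n k m * ‖z‖ ^ m := by
  rw [negPolylogCoeff, Finset.sum_mul]
  refine Finset.sum_congr rfl fun j _ => ?_
  rw [negPolylog_term, norm_mul, norm_pow, Complex.norm_real, Real.norm_of_nonneg (by positivity)]

theorem doublePolylog_neg_eq (n k : ℕ) (z : ℂ) :
    doublePolylog (-(n : ℤ)) k z = ∑' m : ℕ, (negPolylogCoeff n k m : ℂ) * z ^ m := by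
  refine tsum_congr fun m => ?_
  simp only [negPolylog_term, negPolylogCoeff, Complex.ofReal_sum, Finset.sum_mul]

theorem negPolylogCoeff_le_one {n k : ℕ} (hk : n + 1 < k) (m : ℕ) :
    negPolylogCoeff n k m ≤ 1 := by
  refine (negPolylogCoeff_le hk m).trans ?_
  rcases Nat.eq_zero_or_pos m with rfl | hm
  · simp
  · rw [div_le_one (by positivity)]
    exact_mod_cast hm

theorem summable_negPolylog {n k : ℕ} (hk : n + 1 < k) {r : ℝ} (hr0 : 0 ≤ r) (hr : r < 1) :
    Summable fun m : ℕ => negPolylogCoeff n k m * r ^ m := by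
  refine Summable.of_nonneg_of_le
    (fun m => mul_nonneg (negPolylogCoeff_nonneg n k m) (pow_nonneg hr0 m)) (fun m => ?_)
    (summable_geometric_of_lt_one hr0 hr)
  exact mul_le_of_le_one_left (pow_nonneg hr0 m) (negPolylogCoeff_le_one hk m)

theorem differentiableAt_doublePolylog_neg {n k : ℕ} (hk : n + 1 < k) {z : ℂ} (hz : ‖z‖ < 1) :
    DifferentiableAt ℂ (doublePolylog (-(n : ℤ)) k) z := by
  obtain ⟨r, hzr, hr⟩ := exists_between hz
  have hr0 : 0 ≤ r := (norm_nonneg z).trans hzr.le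
  have h : DifferentiableOn ℂ (fun w => ∑' m : ℕ, (negPolylogCoeff n k m : ℂ) * w ^ m)
      (Metric.ball 0 r) := by
    refine Complex.differentiableOn_tsum_of_summable_norm (summable_negPolylog hk hr0 hr)
      (fun m => ((differentiable_id.pow m).const_mul _).differentiableOn) Metric.isOpen_ball
      fun m w hw => ?_
    rw [norm_mul, norm_pow, Complex.norm_real,
      Real.norm_of_nonneg (negPolylogCoeff_nonneg n k m)]
    have : ‖w‖ ≤ r := (mem_ball_zero_iff.mp hw).le
    have := negPolylogCoeff_nonneg n k m
    gcongr
  rw [funext (doublePolylog_neg_eq n k)]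
  exact h.differentiableAt (Metric.isOpen_ball.mem_nhds (mem_ball_zero_iff.mpr hzr))

theorem norm_doublePolylog_neg_le {n k : ℕ} (hk : n + 1 < k) {x : ℝ} (hx0 : 0 ≤ x) (hx : x < 1) :
    ‖doublePolylog (-(n : ℤ)) k x‖ ≤ -Real.log (1 - x) := by
  have hlog : HasSum (fun m : ℕ => x ^ m / (m : ℝ)) (-Real.log (1 - x)) := by
    -- The term at index `0` is `1 / 0 = 0`, so the logarithm series may start there.
    rw [← hasSum_nat_add_iff' 1]
    simpa using Real.hasSum_pow_div_log_of_abs_lt_one (by rwa [abs_of_nonneg hx0])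
  rw [doublePolylog_neg_eq]
  refine tsum_of_norm_bounded hlog fun m => ?_
  rw [norm_mul, norm_pow, Complex.norm_real, Complex.norm_real, Real.norm_of_nonneg hx0,
    Real.norm_of_nonneg (negPolylogCoeff_nonneg n k m), div_eq_mul_one_div, mul_comm]
  gcongr
  exact negPolylogCoeff_le hk m

/-! ### Decay and Taylor expansion of the kernel -/

theorem norm_one_sub_exp_neg_lt_one {t : ℝ} (ht : 0 < t) :
    ‖1 - Complex.exp (-(t : ℂ))‖ < 1 := by
  have h : 1 - Complex.exp (-(t : ℂ)) = ((1 - Real.exp (-t) : ℝ) : ℂ) := by push_cast; rfl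
  have h1 : Real.exp (-t) < 1 := Real.exp_lt_one_iff.mpr (by linarith)
  rw [h, Complex.norm_real, Real.norm_of_nonneg (by linarith)]
  linarith [Real.exp_pos (-t)]

theorem norm_xiKernel_neg_le {n k : ℕ} (hk : n + 1 < k) {t : ℝ} (ht : 0 < t) :
    ‖xiKernel (-(n : ℤ)) k t‖ ≤ t / (Real.exp t - 1) := by
  have h : 1 - Complex.exp (-(t : ℂ)) = ((1 - Real.exp (-t) : ℝ) : ℂ) := by push_cast; rfl
  have h' : Complex.exp (t : ℂ) - 1 = ((Real.exp t - 1 : ℝ) : ℂ) := by push_cast; rfl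
  have h1 : Real.exp (-t) < 1 := Real.exp_lt_one_iff.mpr (by linarith)
  have h2 : 1 < Real.exp t := Real.one_lt_exp_iff.mpr ht
  have h3 := norm_doublePolylog_neg_le hk (x := 1 - Real.exp (-t)) (by linarith)
    (by linarith [Real.exp_pos (-t)])
  rw [sub_sub_cancel, Real.log_exp, neg_neg] at h3
  rw [xiKernel, h, h', norm_div, Complex.norm_real, Real.norm_of_nonneg (by linarith)]
  gcongr

/-- Half of the exponent is given up to absorb the factor `t` in `t / (e^t - 1)`. -/
theorem xiKernel_neg_isBigO_exp {n k : ℕ} (hk : n + 1 < k) :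
    (fun t : ℝ => xiKernel (-(n : ℤ)) k t) =O[atTop] fun t => Real.exp (-(1 / 2) * t) := by
  refine Asymptotics.IsBigO.of_bound 2 ?_
  filter_upwards [eventually_gt_atTop 0] with t ht
  refine (norm_xiKernel_neg_le hk ht).trans ?_
  rw [Real.norm_of_nonneg (Real.exp_pos _).le]
  have h1 : t / 2 + 1 ≤ Real.exp (t / 2) := Real.add_one_le_exp _
  have h2 : Real.exp t = Real.exp (t / 2) * Real.exp (t / 2) := by
    rw [← Real.exp_add]; ring_nf
  have h3 : Real.exp (-(1 / 2) * t) * Real.exp (t / 2) = 1 := by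
    rw [← Real.exp_add, Real.exp_eq_one_iff]; ring
  have h4 : 1 < Real.exp t := Real.one_lt_exp_iff.mpr ht
  rw [div_le_iff₀ (by linarith)]
  have h5 : Real.exp (-(1 / 2) * t) < 1 := Real.exp_lt_one_iff.mpr (by linarith)
  calc t ≤ 2 * (Real.exp (t / 2) - Real.exp (-(1 / 2) * t)) := by linarith
    _ = 2 * Real.exp (-(1 / 2) * t) * (Real.exp t - 1) := by
      rw [h2]
      linear_combination (-2 * Real.exp (t / 2)) * h3

theorem continuousOn_xiKernel_neg {n k : ℕ} (hk : n + 1 < k) :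
    ContinuousOn (fun t : ℝ => xiKernel (-(n : ℤ)) k t) (Set.Ioi 0) := by
  intro t ht
  refine ContinuousAt.continuousWithinAt ?_
  have hc : ContinuousAt (fun t : ℝ => 1 - Complex.exp (-(t : ℂ))) t := by fun_prop
  refine ContinuousAt.div ?_ (by fun_prop) ?_
  · exact ContinuousAt.comp (f := fun t : ℝ => 1 - Complex.exp (-(t : ℂ)))
      (differentiableAt_doublePolylog_neg hk (norm_one_sub_exp_neg_lt_one ht)).continuousAt hc
  · have h2 : 1 < Real.exp t := Real.one_lt_exp_iff.mpr ht
    rw [← Complex.ofReal_exp, ← Complex.ofReal_one, ← Complex.ofReal_sub]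
    exact Complex.ofReal_ne_zero.mpr (by linarith)

theorem analyticAt_xiKernel_neg_update {n k : ℕ} (hk : n + 1 < k) :
    AnalyticAt ℂ (Function.update (xiKernel (-(n : ℤ)) k) 0
      (limUnder (𝓝[≠] (0 : ℂ)) (xiKernel (-(n : ℤ)) k))) 0 := by
  have hLi : AnalyticAt ℂ (doublePolylog (-(n : ℤ)) k) 0 := by
    refine (DifferentiableOn.analyticAt (s := Metric.ball 0 1) (fun z hz => ?_)
      (Metric.ball_mem_nhds 0 one_pos))
    exact (differentiableAt_doublePolylog_neg hk (mem_ball_zero_iff.mp hz)).differentiableWithinAt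
  refine analyticAt_update_div_of_simple_zero
    (f := fun t => doublePolylog (-(n : ℤ)) k (1 - Complex.exp (-t)))
    (g := fun t => Complex.exp t - 1) ?_ (by fun_prop) ?_ (by simp) (by simp) fun z => rfl
  · exact AnalyticAt.fun_comp (by simpa using hLi) (by fun_prop)
  · simp only [neg_zero, Complex.exp_zero, sub_self, doublePolylog_neg_eq]
    refine (tsum_congr fun m => ?_).trans tsum_zero
    rcases Nat.eq_zero_or_pos m with rfl | hm
    · simp [negPolylogCoeff]
    · simp [hm.ne']

theorem xiKernel_neg_sub_taylor_isBigO {n k : ℕ} (hk : n + 1 < k) (N : ℕ) :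
    (fun t : ℝ => xiKernel (-(n : ℤ)) k t - ∑ j ∈ Finset.range N,
      multiPolyBernoulliC (-(n : ℤ)) k j / (j.factorial : ℂ) * (t : ℂ) ^ j)
      =O[𝓝[>] 0] fun t : ℝ => t ^ N := by
  have h := (analyticAt_xiKernel_neg_update hk).hasFPowerSeriesAt.isBigO_sub_partialSum_pow N
  have ht : Tendsto (fun t : ℝ => (t : ℂ)) (𝓝[>] 0) (𝓝 0) := by
    have : Tendsto (fun t : ℝ => (t : ℂ)) (𝓝 0) (𝓝 ((0 : ℝ) : ℂ)) :=
      Complex.continuous_ofReal.tendsto 0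
    exact (by simpa using this : Tendsto (fun t : ℝ => (t : ℂ)) (𝓝 0) (𝓝 0)).mono_left
      nhdsWithin_le_nhds
  refine (h.comp_tendsto ht).congr' ?_ ?_
  · filter_upwards [self_mem_nhdsWithin] with t ht
    have : (t : ℂ) ≠ 0 := Complex.ofReal_ne_zero.mpr (ne_of_gt ht)
    simp [FormalMultilinearSeries.partialSum, Function.update_of_ne this, multiPolyBernoulliC,
      mul_comm]
  · filter_upwards [self_mem_nhdsWithin] with t ht
    simp [abs_of_pos (Set.mem_Ioi.mp ht)]

theorem xiKernel_neg_hasSum {n k : ℕ} (hk : n + 1 < k) :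
    ∀ᶠ t in 𝓝[≠] (0 : ℂ), HasSum
      (fun m : ℕ => multiPolyBernoulliC (-(n : ℤ)) (k : ℤ) m * t ^ m / (m.factorial : ℂ))
      (xiKernel (-(n : ℤ)) (k : ℤ) t) := by
  have h := (analyticAt_xiKernel_neg_update hk).hasFPowerSeriesAt.eventually_hasSum
  filter_upwards [h.filter_mono nhdsWithin_le_nhds, self_mem_nhdsWithin] with t ht ht0
  rw [zero_add, Function.update_of_ne ht0] at ht
  refine ht.congr_fun fun m => ?_
  simp only [FormalMultilinearSeries.apply_eq_prod_smul_coeff, Finset.prod_const,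
    Finset.card_univ, Fintype.card_fin, FormalMultilinearSeries.coeff_ofScalars, smul_eq_mul,
    multiPolyBernoulliC]
  ring

/-! ### The main theorem -/

theorem mainTheorem9 (n k : ℕ) (hk : n + 1 < k) :
    -- the defining series and integral of `ξ(-n,k;s)` converge absolutely
    (∀ z : ℂ, ‖z‖ < 1 → Summable fun m₂ : ℕ =>
      ∑ m₁ ∈ Finset.Ico 1 m₂, ‖z ^ m₂ / ((m₁ : ℂ) ^ (-(n : ℤ)) * (m₂ : ℂ) ^ (k : ℤ))‖) ∧
    (∀ s : ℂ, 0 < s.re → IntegrableOn (xiIntegrand (-(n : ℤ)) (k : ℤ) s) (Set.Ioi 0)) ∧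
    -- the numbers `C_m^{(-n,k)}` have the stated generating function
    (∀ᶠ t in 𝓝[≠] (0 : ℂ), HasSum
      (fun m : ℕ => multiPolyBernoulliC (-(n : ℤ)) (k : ℤ) m * t ^ m / (m.factorial : ℂ))
      (xiKernel (-(n : ℤ)) (k : ℤ) t)) ∧
    -- entire continuation and its values at the nonpositive integers
    ∃ Ξ : ℂ → ℂ, Differentiable ℂ Ξ ∧
      (∀ s : ℂ, 0 < s.re → Ξ s = xiIntegral (-(n : ℤ)) (k : ℤ) s) ∧
      ∀ m : ℕ, Ξ (-(m : ℂ)) = (-1) ^ m * multiPolyBernoulliC (-(n : ℤ)) (k : ℤ) m := by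
  have hloc := (continuousOn_xiKernel_neg hk).locallyIntegrableOn (μ := volume) measurableSet_Ioi
  have htop := xiKernel_neg_isBigO_exp hk
  refine ⟨fun z hz => ?_, fun s hs => ?_, xiKernel_neg_hasSum hk, ?_⟩
  · simp only [negPolylog_sum_norm]
    exact summable_negPolylog hk (norm_nonneg z) hz
  · exact mellinConvergent_of_isBigO_rpow_exp (by norm_num : (0 : ℝ) < 1 / 2) hloc htop
      -- The expansion with `N = 0` is just boundedness near `0`.
      (b := 0) (by simpa using xiKernel_neg_sub_taylor_isBigO hk 0) hs
  · obtain ⟨Ξ, hd, hint, hval⟩ := exists_entire_continuation_mellin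
      (by norm_num : (0 : ℝ) < 1 / 2) hloc htop (xiKernel_neg_sub_taylor_isBigO hk)
    refine ⟨Ξ, hd, fun s hs => ?_, fun m => ?_⟩
    · rw [hint s hs, xiIntegral, one_div]
      rfl
    · rw [hval, mul_div_cancel₀ _ (Nat.cast_ne_zero.mpr m.factorial_ne_zero)]
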